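/- Let $\mathcal H$ be a complex Hilbert space and let $A$ be a closed symmetric linear operator in $\mathcal H$, not necessarily densely defined. Its adjoint is the closed linear relation $A^*=\{(\eta,\omega)\in\mathcal H\oplus\mathcal H:\langle\eta,A\varphi\rangle=\langle\omega,\varphi\rangle\text{ for all }\varphi\in\operatorname{dom}(A)\}$. Assume that $A$ has deficiency indices $(1,1)$, i.e. $\dim\ker(A^*-iI)=\dim\ker(A^*+iI)=1$, and that $A$ is regular, i.e. for every $z\in\mathbb C$ there is $d_z>0$ with $\|(A-zI)\psi\|\ge d_z\|\psi\|$ for all $\psi\in\operatorname{dom}(A)$. A canonical selfadjoint extension of $A$ is a linear relation (subspace) $B\subseteq\mathcal H\oplus\mathcal H$ with $\operatorname{graph}(A)\subseteq B\subseteq A^*$ and $B^*=B$; it may be multivalued. The spectrum $\operatorname{Sp}(B)$ is the complement of the set of all $z\in\mathbb C$ such that $(B-zI)^{-1}$ is a bounded operator defined on all of $\mathcal H$. Then: (i) The spectrum of every canonical selfadjoint extension $B$ of $A$ consists solely of isolated real eigenvalues of multiplicity one: every $z\in\operatorname{Sp}(B)$ is real, is an isolated point of $\operatorname{Sp}(B)$,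 and satisfies $\dim\{\eta\in\mathcal H:(\eta,z\eta)\in B\}=1$. (ii) Every real number belongs to the spectrum of one, and only one, canonical selfadjoint extension of $A$. (iii) The spectra of the canonical selfadjoint extensions of $A$ are pairwise interlaced: if $B_1\ne B_2$ are canonical selfadjoint extensions of $A$, then $\operatorname{Sp}(B_1)\cap\operatorname{Sp}(B_2)=\emptyset$, and strictly between any two consecutive points of either spectrum there lies exactly one point of the other. -/

import Mathlib

open scoped Topology

namespace LinRel

/-! A linear relation in `H` is a linear subspace of `H × H`; an operator is identified with its
graph. The adjoint of a relation is Mathlib's `Submodule.adjoint`, which consists of all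
`(η, ω)` with `⟪b, η⟫ = ⟪a, ω⟫` for every `(a, b)` in the relation. -/

variable {H : Type*} [NormedAddCommGroup H] [InnerProductSpace ℂ H]

/-- The relation `(B - z I)⁻¹`, that is, all `(ω - z η, η)` with `(η, ω) ∈ B`. -/
def shiftInv (B : Submodule ℂ (H × H)) (z : ℂ) : Submodule ℂ (H × H) :=
  B.map ((LinearMap.snd ℂ H H - z • LinearMap.fst ℂ H H).prod (LinearMap.fst ℂ H H))

/-- The kernel of `B - z I`, that is, all `η` with `(η, z η) ∈ B`. -/
def kerShift (B : Submodule ℂ (H × H)) (z : ℂ) : Submodule ℂ H :=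
  B.comap (LinearMap.id.prod (z • LinearMap.id))

/-- The resolvent set of `B`: all `z` such that `(B - z I)⁻¹` is (the graph of) a bounded
operator defined on all of `H`. -/
def resolventSet (B : Submodule ℂ (H × H)) : Set ℂ :=
  {z | ∃ R : H →L[ℂ] H, shiftInv B z = (R : H →ₗ[ℂ] H).graph}

/-- The spectrum of `B`: the complement of the resolvent set. -/
def spectrum (B : Submodule ℂ (H × H)) : Set ℂ :=
  (resolventSet B)ᶜ

/-- The real points of the spectrum of `B`. -/
def realSpectrum (B : Submodule ℂ (H × H)) : Set ℝ :=
  {x | (x : ℂ) ∈ spectrum B}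

/-- A canonical selfadjoint extension of the operator `A` (not necessarily densely defined):
a linear relation between the graph of `A` and its adjoint that is equal to its own adjoint. -/
structure IsCanonicalSelfAdjointExtension (A : H →ₗ.[ℂ] H) (B : Submodule ℂ (H × H)) : Prop where
  graph_le : A.graph ≤ B
  le_adjoint : B ≤ A.graph.adjoint
  adjoint_eq : B.adjoint = B

/-- The operator `A` has deficiency indices `(1, 1)`: the kernels of `A* - i I` and of `A* + i I`
are one-dimensional, where `A*` is the adjoint relation. -/
def HasDeficiencyIndicesOneOne (A : H →ₗ.[ℂ] H) : Prop :=
  Module.finrank ℂ (kerShift A.graph.adjoint Complex.I) = 1 ∧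
    Module.finrank ℂ (kerShift A.graph.adjoint (-Complex.I)) = 1

/-- The operator `A` is regular: every complex number is a point of regular type. -/
def IsRegular (A : H →ₗ.[ℂ] H) : Prop :=
  ∀ z : ℂ, ∃ d : ℝ, 0 < d ∧ ∀ ψ : A.domain, d * ‖ψ‖ ≤ ‖A ψ - z • (ψ : H)‖

/-- The class `S(H)` of regular, closed, symmetric operators with deficiency indices `(1, 1)`.
The domain is not required to be dense. -/
structure ClassS (A : H →ₗ.[ℂ] H) : Prop where
  isClosed : A.IsClosed
  symmetric : ∀ φ ψ : A.domain, inner ℂ (A φ) (ψ : H) = inner ℂ (φ : H) (A ψ)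
  deficiency : HasDeficiencyIndicesOneOne A
  regular : IsRegular A

/-- Two sets of real numbers are interlaced: they are disjoint, and strictly between any two
consecutive points of either set there is exactly one point of the other. -/
def Interlaced (S T : Set ℝ) : Prop :=
  Disjoint S T ∧
    (∀ a ∈ S, ∀ b ∈ S, a < b → S ∩ Set.Ioo a b = ∅ → ∃! t, t ∈ T ∧ t ∈ Set.Ioo a b) ∧
    (∀ a ∈ T, ∀ b ∈ T, a < b → T ∩ Set.Ioo a b = ∅ → ∃! s, s ∈ S ∧ s ∈ Set.Ioo a b)

end LinRel

/-!
Let `G` be the graph of `A`. Write `N z` for the kernel of `G.adjoint - z I`; it is the orthogonal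
complement of the range of `G - conj z I`.

*The deficiency is one everywhere.* If `G - z I` is bounded below by `d` and `‖z - w‖ < d`, no
nonzero vector of the range of `G - z I` is orthogonal to the range of `G - w I`
(`BoundedBelow.eq_zero_of_mem_ranShift`). So the orthogonal projection embeds the orthogonal
complement of one range into that of the other, the rank of the complement is locally constant in
`z`, and `N z` is one-dimensional for every `z`, not only at `± i`.

*Eigenvalues.* The range of `B - z I`, for a selfadjoint extension `B`, contains the closed subspace
`ran (G - z I)` of codimension one, and its orthogonal complement is the kernel of `B - conj z I`.
So `B - z I` is bijective unless `z` is a real eigenvalue with eigenspace `N z`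
(`IsSelfAdjointExtension.mem_spectrum_iff`). In that case `B` is `G` together with all `(n, z n)`,
`n ∈ N z`, and this relation is selfadjoint for every real `z`; thus each real number is in the
spectrum of exactly one extension. Eigenvectors of `B` for different eigenvalues are orthogonal,
and by the fact above this keeps eigenvalues a definite distance apart
(`IsSelfAdjointExtension.le_norm_sub`).

*Interlacing.* Let `a < b` be in the spectrum of `B₁`, with midpoint `c` and half distance `r`, and
let `B₂ ≠ B₁`. The spectra are disjoint; if that of `B₂` misses the open interval, it misses the
closed one, and the selfadjoint bounded operator `(B₂ - c I)⁻¹` has spectral radius, hence norm,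
less than `r⁻¹`. But `G` has codimension one in `B₁`, so some nonzero combination of the
eigenvectors of `B₁` for `a` and `b` is in the domain of `A`, and `A - c I` multiplies its norm by
exactly `r`. This contradiction gives a point of the spectrum of `B₂` between `a` and `b`
(`IsSelfAdjointExtension.exists_mem_spectrum_Ioo`); exchanging the roles of `B₁` and `B₂`, two such
points would have a point of the spectrum of `B₁` between them, so there is only one if `a` and `b`
are consecutive.
-/

namespace LinRel

open scoped ComplexConjugate

variable {H : Type*} [NormedAddCommGroup H] [InnerProductSpace ℂ H]

/-! ### Ranges, kernels and adjoints of linear relations -/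

/-- The range of `G - z I`, that is, all `ω - z η` with `(η, ω) ∈ G`. -/
def ranShift (G : Submodule ℂ (H × H)) (z : ℂ) : Submodule ℂ H :=
  G.map (LinearMap.snd ℂ H H - z • LinearMap.fst ℂ H H)

theorem mem_ranShift {G : Submodule ℂ (H × H)} {z : ℂ} {v : H} :
    v ∈ ranShift G z ↔ ∃ η ω, (η, ω) ∈ G ∧ ω - z • η = v := by
  simp [ranShift]

theorem ranShift_mono {G B : Submodule ℂ (H × H)} (h : G ≤ B) (z : ℂ) :
    ranShift G z ≤ ranShift B z :=
  Submodule.map_mono h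

theorem mem_kerShift {G : Submodule ℂ (H × H)} {z : ℂ} {η : H} :
    η ∈ kerShift G z ↔ (η, z • η) ∈ G :=
  Iff.rfl

theorem kerShift_mono {G B : Submodule ℂ (H × H)} (h : G ≤ B) (z : ℂ) :
    kerShift G z ≤ kerShift B z :=
  Submodule.comap_mono h

theorem mem_shiftInv {B : Submodule ℂ (H × H)} {z : ℂ} {v η : H} :
    (v, η) ∈ shiftInv B z ↔ (η, v + z • η) ∈ B := by
  constructor
  · rintro ⟨⟨a, b⟩, hab, h⟩
    have h1 : b - z • a = v := congrArg Prod.fst h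
    have h2 : a = η := congrArg Prod.snd h
    subst h1 h2
    simpa using hab
  · intro h
    exact ⟨(η, v + z • η), h, Prod.ext (add_sub_cancel_right v (z • η)) rfl⟩

theorem mem_adjoint {G : Submodule ℂ (H × H)} {η ω : H} :
    (η, ω) ∈ G.adjoint ↔ ∀ a b, (a, b) ∈ G → inner ℂ b η = inner ℂ a ω := by
  rw [Submodule.mem_adjoint_iff]
  exact forall₃_congr fun a b _ => sub_eq_zero

theorem adjoint_antitone {G B : Submodule ℂ (H × H)} (h : G ≤ B) : B.adjoint ≤ G.adjoint := by
  rintro ⟨η, ω⟩ hx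
  rw [mem_adjoint] at hx ⊢
  exact fun a b hab => hx a b (h hab)

theorem isClosed_adjoint (G : Submodule ℂ (H × H)) :
    IsClosed (G.adjoint : Set (H × H)) := by
  have : (G.adjoint : Set (H × H)) =
      ⋂ p ∈ G, {x : H × H | inner ℂ p.2 x.1 = inner ℂ p.1 x.2} := by
    ext ⟨η, ω⟩
    rw [SetLike.mem_coe, mem_adjoint]
    simp
  rw [this]
  exact isClosed_biInter fun p _ => isClosed_eq (by fun_prop) (by fun_prop)

theorem orthogonal_ranShift (G : Submodule ℂ (H × H)) (z : ℂ) :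
    (ranShift G z)ᗮ = kerShift G.adjoint (conj z) := by
  ext η
  rw [Submodule.mem_orthogonal, mem_kerShift, mem_adjoint]
  have key : ∀ a b : H, inner ℂ (b - z • a) η = 0 ↔ inner ℂ b η = inner ℂ a (conj z • η) := by
    intro a b
    rw [inner_sub_left, inner_smul_left, inner_smul_right, sub_eq_zero]
  constructor
  · intro h a b hab
    exact (key a b).1 (h _ (mem_ranShift.2 ⟨a, b, hab, rfl⟩))
  · rintro h _ hu
    obtain ⟨a, b, hab, rfl⟩ := mem_ranShift.1 hu
    exact (key a b).2 (h a b hab)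

/-! ### Points of regular type -/

/-- `G - z I` is bounded below by `d`. -/
def BoundedBelow (G : Submodule ℂ (H × H)) (z : ℂ) (d : ℝ) : Prop :=
  ∀ η ω, (η, ω) ∈ G → d * ‖η‖ ≤ ‖ω - z • η‖

theorem BoundedBelow.perturb {G : Submodule ℂ (H × H)} {z : ℂ} {d : ℝ}
    (h : BoundedBelow G z d) (w : ℂ) : BoundedBelow G w (d - ‖z - w‖) := by
  intro η ω hm
  have h1 := h η ω hm
  have h2 : ω - z • η = (ω - w • η) - (z - w) • η := by module
  have h3 : ‖ω - z • η‖ ≤ ‖ω - w • η‖ + ‖z - w‖ * ‖η‖ := by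
    rw [h2, ← norm_smul]
    exact norm_sub_le _ _
  linarith

theorem BoundedBelow.isClosed_ranShift [CompleteSpace H] {G : Submodule ℂ (H × H)} {z : ℂ} {d : ℝ}
    (h : BoundedBelow G z d) (hd : 0 < d) (hG : IsClosed (G : Set (H × H))) :
    IsClosed (ranShift G z : Set H) := by
  let T : G →L[ℂ] H :=
    (ContinuousLinearMap.snd ℂ H H - z • ContinuousLinearMap.fst ℂ H H).comp G.subtypeL
  have hT : ∀ x : G, T x = x.1.2 - z • x.1.1 := fun x => rfl
  have : CompleteSpace G := hG.completeSpace_coe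
  have hK : (0 : ℝ) ≤ d⁻¹ + (1 + ‖z‖ * d⁻¹) := by positivity
  have hanti : AntilipschitzWith ⟨_, hK⟩ T := by
    refine T.antilipschitz_of_bound fun x => ?_
    obtain ⟨⟨η, ω⟩, hx⟩ := x
    rw [hT]
    change ‖(η, ω)‖ ≤ (d⁻¹ + (1 + ‖z‖ * d⁻¹)) * ‖ω - z • η‖
    have h1 : ‖η‖ ≤ d⁻¹ * ‖ω - z • η‖ := by
      rw [inv_mul_eq_div, le_div_iff₀ hd, mul_comm]
      exact h η ω hx
    have h2 : ‖ω‖ ≤ ‖ω - z • η‖ + ‖z‖ * ‖η‖ := by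
      rw [← norm_smul]
      simpa using norm_add_le (ω - z • η) (z • η)
    have h3 : ‖z‖ * ‖η‖ ≤ ‖z‖ * (d⁻¹ * ‖ω - z • η‖) := by gcongr
    have h4 : 0 ≤ ‖z‖ * (d⁻¹ * ‖ω - z • η‖) := by positivity
    have h5 : 0 ≤ d⁻¹ * ‖ω - z • η‖ := by positivity
    have h6 := norm_nonneg (ω - z • η)
    exact max_le (by dsimp only; linarith) (by dsimp only; linarith)
  have hr : (ranShift G z : Set H) = Set.range T := by
    ext v
    simp only [SetLike.mem_coe, mem_ranShift, Set.mem_range, hT, Subtype.exists, Prod.exists,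
      exists_prop]
  rw [hr]
  exact hanti.isClosed_range T.uniformContinuous

/-- If `G - z I` is bounded below by `d`, then for `‖z - w‖ < d` the range of `G - z I` contains no
nonzero vector orthogonal to the range of `G - w I`. -/
theorem BoundedBelow.eq_zero_of_mem_ranShift {G : Submodule ℂ (H × H)} {z w : ℂ} {d : ℝ}
    (h : BoundedBelow G z d) (hzw : ‖z - w‖ < d) {u : H} (hu : u ∈ ranShift G z)
    (hu' : u ∈ (ranShift G w)ᗮ) : u = 0 := by
  obtain ⟨η, ω, hm, rfl⟩ := mem_ranShift.1 hu
  have h1 := h η ω hm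
  set u := ω - z • η with hudef
  have h2 : inner ℂ (ω - w • η) u = 0 :=
    Submodule.inner_right_of_mem_orthogonal (mem_ranShift.2 ⟨η, ω, hm, rfl⟩) hu'
  have h3 : ω - w • η = u + (z - w) • η := by rw [hudef]; module
  rw [h3, inner_add_left, inner_self_eq_norm_sq_to_K] at h2
  have h4 : ‖u‖ ^ 2 ≤ ‖z - w‖ * ‖η‖ * ‖u‖ := by
    have h5 : ((‖u‖ : ℂ)) ^ 2 = - inner ℂ ((z - w) • η) u := eq_neg_of_add_eq_zero_left h2
    have h6 := congrArg norm h5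
    rw [norm_neg, norm_pow, Complex.norm_real, norm_norm] at h6
    rw [h6, ← norm_smul]
    exact norm_inner_le_norm _ _
  by_contra hne
  have hpos : 0 < ‖u‖ := norm_pos_iff.2 hne
  have h7 : ‖u‖ ≤ ‖z - w‖ * ‖η‖ := by
    rw [sq] at h4
    exact le_of_mul_le_mul_right h4 hpos
  have hη : 0 < ‖η‖ := by
    rcases (norm_nonneg η).eq_or_lt with h0 | h0
    · rw [← h0, mul_zero] at h7
      linarith
    · exact h0
  nlinarith

theorem BoundedBelow.rank_orthogonal_le [CompleteSpace H] {G : Submodule ℂ (H × H)} {z w : ℂ}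
    {d : ℝ} (h : BoundedBelow G z d) (hG : IsClosed (G : Set (H × H))) (hzw : ‖z - w‖ < d) :
    Module.rank ℂ (ranShift G w)ᗮ ≤ Module.rank ℂ (ranShift G z)ᗮ := by
  have hcl := h.isClosed_ranShift ((norm_nonneg _).trans_lt hzw) hG
  -- the orthogonal projection onto the second space is injective on the first
  let P : (ranShift G w)ᗮ →ₗ[ℂ] (ranShift G z)ᗮ :=
    ((ranShift G z)ᗮ.orthogonalProjectionOnto : H →ₗ[ℂ] (ranShift G z)ᗮ).comp
      (ranShift G w)ᗮ.subtype
  refine LinearMap.rank_le_of_injective P ((injective_iff_map_eq_zero P).2 fun x hx => ?_)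
  have hx' : (x : H) ∈ (ranShift G z)ᗮᗮ := Submodule.orthogonalProjectionOnto_eq_zero_iff.1 hx
  rw [Submodule.orthogonal_orthogonal_eq_closure, hcl.submodule_topologicalClosure_eq] at hx'
  exact Subtype.ext (h.eq_zero_of_mem_ranShift hzw hx' x.2)

/-- The deficiency of a closed relation bounded below at every point is constant: its rank is
locally constant and the complex plane is connected. -/
theorem rank_orthogonal_ranShift_eq [CompleteSpace H] {G : Submodule ℂ (H × H)}
    (hG : IsClosed (G : Set (H × H))) (hreg : ∀ z, ∃ d > 0, BoundedBelow G z d) (z w : ℂ) :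
    Module.rank ℂ (ranShift G z)ᗮ = Module.rank ℂ (ranShift G w)ᗮ := by
  have hloc : IsLocallyConstant fun z => Module.rank ℂ (ranShift G z)ᗮ := by
    rw [IsLocallyConstant.iff_eventually_eq]
    intro z
    obtain ⟨d, hd, h⟩ := hreg z
    filter_upwards [Metric.ball_mem_nhds z (half_pos hd)] with w hw
    have hw' : ‖z - w‖ < d / 2 := by rwa [Metric.mem_ball, dist_comm, dist_eq_norm] at hw
    refine le_antisymm (h.rank_orthogonal_le hG (by linarith))
      ((h.perturb w).rank_orthogonal_le hG ?_)
    rw [norm_sub_rev w z]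
    linarith
  exact hloc.apply_eq_of_preconnectedSpace z w

/-- The data on the graph `G` of an operator in the class `S(H)` that the spectral theory of its
extensions uses; the deficiency is one at every point of the plane. -/
structure IsRegularOneOne (G : Submodule ℂ (H × H)) : Prop where
  isClosed : IsClosed (G : Set (H × H))
  le_adjoint : G ≤ G.adjoint
  boundedBelow : ∀ z, ∃ d > 0, BoundedBelow G z d
  finrank_eq_one : ∀ z, Module.finrank ℂ (kerShift G.adjoint z) = 1

theorem ClassS.isRegularOneOne [CompleteSpace H] {A : H →ₗ.[ℂ] H} (hA : ClassS A) :
    IsRegularOneOne A.graph := by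
  have hreg : ∀ z, ∃ d > 0, BoundedBelow A.graph z d := by
    intro z
    obtain ⟨d, hd, h⟩ := hA.regular z
    refine ⟨d, hd, fun η ω hm => ?_⟩
    obtain ⟨ψ, rfl, rfl⟩ := A.mem_graph_iff.1 hm
    exact h ψ
  refine ⟨hA.isClosed, ?_, hreg, fun z => ?_⟩
  · rintro ⟨η, ω⟩ hm
    obtain ⟨ψ, rfl, rfl⟩ := A.mem_graph_iff.1 hm
    refine mem_adjoint.2 fun a b hab => ?_
    obtain ⟨φ, rfl, rfl⟩ := A.mem_graph_iff.1 hab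
    exact hA.symmetric φ ψ
  · have h := rank_orthogonal_ranShift_eq hA.isClosed hreg (conj z) (conj Complex.I)
    rw [orthogonal_ranShift, orthogonal_ranShift, Complex.conj_conj, Complex.conj_conj] at h
    rw [Module.finrank, h]
    exact hA.deficiency.1

/-! ### Selfadjoint extensions and their eigenvalues -/

/-- A selfadjoint relation containing `G`. -/
structure IsSelfAdjointExtension (G B : Submodule ℂ (H × H)) : Prop where
  le : G ≤ B
  adjoint_eq : B.adjoint = B

theorem IsSelfAdjointExtension.le_adjoint {G B : Submodule ℂ (H × H)}
    (hB : IsSelfAdjointExtension G B) : B ≤ G.adjoint :=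
  hB.adjoint_eq.symm.le.trans (adjoint_antitone hB.le)

theorem inner_eq_of_adjoint_eq {B : Submodule ℂ (H × H)} (hB : B.adjoint = B) {η ω η' ω' : H}
    (h : (η, ω) ∈ B) (h' : (η', ω') ∈ B) : inner ℂ ω η' = inner ℂ η ω' := by
  rw [← hB] at h'
  exact mem_adjoint.1 h' _ _ h

/-- An eigenvalue of a selfadjoint relation is real. -/
theorem im_eq_zero_of_kerShift_ne_bot {B : Submodule ℂ (H × H)} (hB : B.adjoint = B) {z : ℂ}
    (h : kerShift B z ≠ ⊥) : z.im = 0 := by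
  obtain ⟨η, hη, hne⟩ := Submodule.exists_mem_ne_zero_of_ne_bot h
  have h1 := inner_eq_of_adjoint_eq hB (mem_kerShift.1 hη) (mem_kerShift.1 hη)
  rw [inner_smul_left, inner_smul_right] at h1
  exact Complex.conj_eq_iff_im.1 (mul_right_cancel₀ (inner_self_ne_zero.2 hne) h1)

/-- A closed relation `B` such that `B - z I` is bijective has `z` in its resolvent set, by the
closed graph theorem. -/
theorem mem_resolventSet_of_bijective [CompleteSpace H] {B : Submodule ℂ (H × H)}
    (hB : IsClosed (B : Set (H × H))) {z : ℂ} (hker : kerShift B z = ⊥)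
    (hran : ranShift B z = ⊤) : z ∈ resolventSet B := by
  have hbij : Function.Bijective (Prod.fst ∘ (shiftInv B z).subtype) := by
    constructor
    · rintro ⟨⟨v, η⟩, hx⟩ ⟨⟨v', η'⟩, hy⟩ (rfl : v = v')
      have hd := sub_mem (mem_shiftInv.1 hx) (mem_shiftInv.1 hy)
      have hk : η - η' ∈ kerShift B z := by
        rw [mem_kerShift]
        convert hd using 1
        ext <;> simp [smul_sub]
      rw [hker, Submodule.mem_bot, sub_eq_zero] at hk
      subst hk
      rfl
    · intro v
      obtain ⟨η, ω, hm, rfl⟩ := mem_ranShift.1 (hran ▸ Submodule.mem_top : v ∈ ranShift B z)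
      exact ⟨⟨(ω - z • η, η), mem_shiftInv.2 (by simpa using hm)⟩, rfl⟩
  obtain ⟨f, hf⟩ := Submodule.exists_eq_graph hbij
  have hcl : IsClosed (f.graph : Set (H × H)) := by
    rw [← hf]
    have : (shiftInv B z : Set (H × H)) =
        (fun p : H × H => (p.2, p.1 + z • p.2)) ⁻¹' (B : Set (H × H)) := by
      ext ⟨v, η⟩
      exact mem_shiftInv
    rw [this]
    exact hB.preimage (by fun_prop)
  exact ⟨ContinuousLinearMap.ofIsClosedGraph hcl, by
    rw [ContinuousLinearMap.coe_ofIsClosedGraph, hf]⟩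

theorem mem_spectrum_of_kerShift_ne_bot {B : Submodule ℂ (H × H)} {z : ℂ}
    (h : kerShift B z ≠ ⊥) : z ∈ spectrum B := by
  rintro ⟨R, hR⟩
  obtain ⟨η, hη, hne⟩ := Submodule.exists_mem_ne_zero_of_ne_bot h
  have h1 : ((0 : H), η) ∈ shiftInv B z := mem_shiftInv.2 (by simpa using mem_kerShift.1 hη)
  rw [hR, LinearMap.mem_graph_iff] at h1
  exact hne (by simpa using h1)

/-- A subspace with trivial orthogonal complement that contains a closed subspace of codimension
one is the whole space. -/
theorem eq_top_of_finrank_orthogonal_eq_one [CompleteSpace H] {K M : Submodule ℂ H}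
    (hK : IsClosed (K : Set H)) (hdim : Module.finrank ℂ Kᗮ = 1) (hKM : K ≤ M) (hM : Mᗮ = ⊥) :
    M = ⊤ := by
  have : CompleteSpace K := hK.completeSpace_coe
  have hnle : ¬ M ≤ K := by
    intro h
    rw [le_antisymm h hKM] at hM
    rw [hM, finrank_bot] at hdim
    exact zero_ne_one hdim
  obtain ⟨m, hmM, hmK⟩ := SetLike.not_le_iff_exists.1 hnle
  obtain ⟨k, hk, n, hn, rfl⟩ := K.exists_add_mem_mem_orthogonal m
  have hnM : n ∈ M := by simpa using M.sub_mem hmM (hKM hk)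
  have hn0 : n ≠ 0 := by
    rintro rfl
    exact hmK (by simpa using hk)
  have hle : Kᗮ ≤ M := by
    intro u hu
    obtain ⟨c, hc⟩ := (finrank_eq_one_iff_of_nonzero' (⟨n, hn⟩ : Kᗮ)
      (fun h => hn0 (congrArg Subtype.val h))).1 hdim ⟨u, hu⟩
    have hc' : c • n = u := congrArg Subtype.val hc
    exact hc' ▸ M.smul_mem c hnM
  rw [eq_top_iff, ← K.sup_orthogonal_of_hasOrthogonalProjection]
  exact sup_le hKM hle

variable {G B B₁ B₂ : Submodule ℂ (H × H)}

theorem IsRegularOneOne.isClosed_ranShift [CompleteSpace H] (hG : IsRegularOneOne G) (z : ℂ) :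
    IsClosed (ranShift G z : Set H) := by
  obtain ⟨d, hd, h⟩ := hG.boundedBelow z
  exact h.isClosed_ranShift hd hG.isClosed

theorem IsRegularOneOne.mem_ranShift_of_orthogonal [CompleteSpace H] (hG : IsRegularOneOne G)
    {z : ℂ} {v : H} (h : v ∈ (kerShift G.adjoint (conj z))ᗮ) : v ∈ ranShift G z := by
  rwa [← orthogonal_ranShift, Submodule.orthogonal_orthogonal_eq_closure,
    (hG.isClosed_ranShift z).submodule_topologicalClosure_eq] at h

/-- The spectrum of a selfadjoint extension consists of eigenvalues: the range of `B - z I`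
contains the closed subspace `ranShift G z` of codimension one, so it is the whole space unless
`conj z` is an eigenvalue, which is then real. -/
theorem IsSelfAdjointExtension.mem_spectrum_iff [CompleteSpace H] (hB : IsSelfAdjointExtension G B)
    (hG : IsRegularOneOne G) {z : ℂ} : z ∈ spectrum B ↔ kerShift B z ≠ ⊥ := by
  refine ⟨fun hz hker => hz ?_, mem_spectrum_of_kerShift_ne_bot⟩
  have hker' : kerShift B (conj z) = ⊥ := by
    by_contra h
    have him := im_eq_zero_of_kerShift_ne_bot hB.adjoint_eq h
    rw [Complex.conj_im, neg_eq_zero] at him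
    rw [Complex.conj_eq_iff_im.2 him] at h
    exact h hker
  refine mem_resolventSet_of_bijective (hB.adjoint_eq ▸ isClosed_adjoint B) hker ?_
  refine eq_top_of_finrank_orthogonal_eq_one (hG.isClosed_ranShift z) ?_ (ranShift_mono hB.le z) ?_
  · rw [orthogonal_ranShift]
    exact hG.finrank_eq_one _
  · rw [orthogonal_ranShift, hB.adjoint_eq, hker']

theorem IsSelfAdjointExtension.im_eq_zero [CompleteSpace H] (hB : IsSelfAdjointExtension G B)
    (hG : IsRegularOneOne G) {z : ℂ} (hz : z ∈ spectrum B) : z.im = 0 :=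
  im_eq_zero_of_kerShift_ne_bot hB.adjoint_eq ((hB.mem_spectrum_iff hG).1 hz)

theorem IsSelfAdjointExtension.kerShift_eq [CompleteSpace H] (hB : IsSelfAdjointExtension G B)
    (hG : IsRegularOneOne G) {z : ℂ} (hz : z ∈ spectrum B) :
    kerShift B z = kerShift G.adjoint z := by
  have hle := kerShift_mono hB.le_adjoint z
  have hne := (hB.mem_spectrum_iff hG).1 hz
  have hone := hG.finrank_eq_one z
  obtain ⟨η, hη, hne⟩ := Submodule.exists_mem_ne_zero_of_ne_bot hne
  refine le_antisymm hle fun u hu => ?_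
  obtain ⟨c, hc⟩ := (finrank_eq_one_iff_of_nonzero' (⟨η, hle hη⟩ : kerShift G.adjoint z)
    (fun h => hne (congrArg Subtype.val h))).1 hone ⟨u, hu⟩
  have hc' : c • η = u := congrArg Subtype.val hc
  exact hc' ▸ Submodule.smul_mem _ c hη

/-- Distinct points `z`, `w` of the spectrum of a selfadjoint extension are at least as far apart
as the lower bound of `G - z I`: an eigenvector for `w` is orthogonal to the eigenspace for `z`,
hence lies in the range of `G - z I`. -/
theorem IsSelfAdjointExtension.le_norm_sub [CompleteSpace H] (hB : IsSelfAdjointExtension G B)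
    (hG : IsRegularOneOne G) {z w : ℂ} {d : ℝ} (hd : BoundedBelow G z d) (hz : z ∈ spectrum B)
    (hw : w ∈ spectrum B) (hne : z ≠ w) : d ≤ ‖z - w‖ := by
  by_contra! hlt
  have hzc := Complex.conj_eq_iff_im.2 (hB.im_eq_zero hG hz)
  have hwc := Complex.conj_eq_iff_im.2 (hB.im_eq_zero hG hw)
  obtain ⟨η, hη, hη0⟩ := Submodule.exists_mem_ne_zero_of_ne_bot ((hB.mem_spectrum_iff hG).1 hw)
  refine hη0 (hd.eq_zero_of_mem_ranShift hlt (hG.mem_ranShift_of_orthogonal ?_) ?_)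
  · rw [hzc, ← hB.kerShift_eq hG hz, Submodule.mem_orthogonal]
    intro u hu
    have h := inner_eq_of_adjoint_eq hB.adjoint_eq (mem_kerShift.1 hu) (mem_kerShift.1 hη)
    rw [inner_smul_left, inner_smul_right, hzc] at h
    by_contra h0
    exact hne (mul_right_cancel₀ h0 h)
  · rw [orthogonal_ranShift, hwc]
    exact kerShift_mono hB.le_adjoint w hη

/-! ### The extension with a prescribed eigenvalue -/

/-- The sum of `G` and the restriction of its adjoint to the eigenspace at `x`. -/
noncomputable def eigenExtension (G : Submodule ℂ (H × H)) (x : ℂ) : Submodule ℂ (H × H) :=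
  G ⊔ (kerShift G.adjoint x).map (LinearMap.id.prod (x • LinearMap.id))

theorem mem_eigenExtension {x : ℂ} {p : H × H} :
    p ∈ eigenExtension G x ↔ ∃ q ∈ G, ∃ n ∈ kerShift G.adjoint x, q + (n, x • n) = p := by
  simp [eigenExtension, Submodule.mem_sup]

/-- If `(η, ω)` is in the adjoint and `ω - x η` is orthogonal to the eigenspace at the real
point `x`, then `(η, ω)` differs from an element of `G` by an eigenvector. -/
theorem IsRegularOneOne.mem_eigenExtension_of_orthogonal [CompleteSpace H]
    (hG : IsRegularOneOne G) {x : ℂ} (hx : conj x = x) {η ω : H} (hm : (η, ω) ∈ G.adjoint)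
    (h : ω - x • η ∈ (kerShift G.adjoint x)ᗮ) : (η, ω) ∈ eigenExtension G x := by
  obtain ⟨φ, ψ, hφ, he⟩ := mem_ranShift.1 (hG.mem_ranShift_of_orthogonal (z := x) (hx.symm ▸ h))
  have heq : ω - ψ = x • (η - φ) := by
    rw [smul_sub, sub_eq_sub_iff_sub_eq_sub]
    rw [hx] at he
    exact he.symm
  refine mem_eigenExtension.2 ⟨(φ, ψ), hφ, η - φ, ?_, ?_⟩
  · rw [mem_kerShift, ← heq]
    exact sub_mem hm (hG.le_adjoint hφ)
  · rw [← heq]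
    simp

theorem IsRegularOneOne.isSelfAdjointExtension_eigenExtension [CompleteSpace H]
    (hG : IsRegularOneOne G) {x : ℂ} (hx : conj x = x) :
    IsSelfAdjointExtension G (eigenExtension G x) := by
  refine ⟨le_sup_left, le_antisymm ?_ ?_⟩
  · rintro ⟨η, ω⟩ hm
    refine hG.mem_eigenExtension_of_orthogonal hx (adjoint_antitone le_sup_left hm) ?_
    rw [Submodule.mem_orthogonal]
    intro n hn
    have h := mem_adjoint.1 hm n (x • n) (mem_eigenExtension.2 ⟨0, G.zero_mem, n, hn, by simp⟩)
    rw [inner_smul_left, hx] at h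
    rw [inner_sub_right, inner_smul_right, h, sub_self]
  · rintro ⟨η, ω⟩ hm
    obtain ⟨⟨φ, ψ⟩, hq, n, hn, he⟩ := mem_eigenExtension.1 hm
    obtain ⟨rfl, rfl⟩ := Prod.mk.inj he
    refine mem_adjoint.2 fun a b hab => ?_
    obtain ⟨⟨φ', ψ'⟩, hq', n', hn', he'⟩ := mem_eigenExtension.1 hab
    obtain ⟨rfl, rfl⟩ := Prod.mk.inj he'
    have h1 := mem_adjoint.1 (hG.le_adjoint hq) _ _ hq'
    have h2 := mem_adjoint.1 (mem_kerShift.1 hn) _ _ hq'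
    have h3 := mem_adjoint.1 (mem_kerShift.1 hn') _ _ hq
    have h4 := congrArg conj h3
    rw [inner_conj_symm, inner_conj_symm] at h4
    simp only [inner_add_left, inner_add_right, inner_smul_left, inner_smul_right, hx] at h2 h4 ⊢
    linear_combination h1 + h2 - h4

/-- A selfadjoint extension with the point `x` in its spectrum is `eigenExtension G x`. -/
theorem IsSelfAdjointExtension.eq_eigenExtension [CompleteSpace H] (hB : IsSelfAdjointExtension G B)
    (hG : IsRegularOneOne G) {x : ℂ} (hx : x ∈ spectrum B) : B = eigenExtension G x := by
  have hxc := Complex.conj_eq_iff_im.2 (hB.im_eq_zero hG hx)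
  have hker := hB.kerShift_eq hG hx
  refine le_antisymm ?_ (sup_le hB.le ?_)
  · rintro ⟨η, ω⟩ hm
    refine hG.mem_eigenExtension_of_orthogonal hxc (hB.le_adjoint hm) ?_
    rw [← hker, Submodule.mem_orthogonal]
    intro n hn
    have h := inner_eq_of_adjoint_eq hB.adjoint_eq (mem_kerShift.1 hn) hm
    rw [inner_smul_left, hxc] at h
    rw [inner_sub_right, inner_smul_right, h, sub_self]
  · rw [← hker]
    rintro _ ⟨n, hn, rfl⟩
    exact hn

theorem IsRegularOneOne.mem_spectrum_eigenExtension (hG : IsRegularOneOne G) {x : ℂ} :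
    x ∈ spectrum (eigenExtension G x) := by
  refine mem_spectrum_of_kerShift_ne_bot fun h => ?_
  have hle : kerShift G.adjoint x ≤ kerShift (eigenExtension G x) x := fun n hn =>
    mem_eigenExtension.2 ⟨0, G.zero_mem, n, hn, by simp⟩
  rw [h, le_bot_iff] at hle
  have h1 := hG.finrank_eq_one x
  rw [hle, finrank_bot] at h1
  exact zero_ne_one h1

theorem IsSelfAdjointExtension.eq_of_mem_spectrum [CompleteSpace H]
    (hB₁ : IsSelfAdjointExtension G B₁) (hB₂ : IsSelfAdjointExtension G B₂)
    (hG : IsRegularOneOne G) {x : ℂ} (h₁ : x ∈ spectrum B₁)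
    (h₂ : x ∈ spectrum B₂) : B₁ = B₂ :=
  (hB₁.eq_eigenExtension hG h₁).trans (hB₂.eq_eigenExtension hG h₂).symm

/-! ### Interlacing -/

/-- If `c + μ` is in the resolvent set of `B`, then `1 - μ R` is invertible, where `R` is the
resolvent of `B` at `c`; the inverse is `1 + μ T`, where `T` is the resolvent at `c + μ`. -/
theorem isUnit_one_sub_smul {c μ : ℂ} {R : H →L[ℂ] H}
    (hR : shiftInv B c = (R : H →ₗ[ℂ] H).graph) (hμ : c + μ ∈ resolventSet B) :
    IsUnit (1 - μ • R) := by
  obtain ⟨T, hT⟩ := hμ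
  have memR : ∀ v η, R v = η ↔ (η, v + c • η) ∈ B := fun v η => by
    rw [← mem_shiftInv, hR, LinearMap.mem_graph_iff]
    exact eq_comm
  have memT : ∀ v η, T v = η ↔ (η, v + (c + μ) • η) ∈ B := fun v η => by
    rw [← mem_shiftInv, hT, LinearMap.mem_graph_iff]
    exact eq_comm
  have h1 : ∀ v, T v - μ • R (T v) = R v := fun v => by
    have h := (memT v _).1 rfl
    have h' : R (v + μ • T v) = T v := (memR _ _).2 (by convert h using 2; module)
    rw [sub_eq_iff_eq_add, ← map_smul, ← map_add, h']
  have h2 : ∀ v, R v + μ • T (R v) = T v := fun v => by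
    have h := (memR v _).1 rfl
    have h' : T (v - μ • R v) = R v := (memT _ _).2 (by convert h using 2; module)
    rw [← eq_sub_iff_add_eq, ← map_smul, ← map_sub, h']
  refine isUnit_iff_exists.2 ⟨1 + μ • T, ?_, ?_⟩
  · ext v
    simp only [mul_apply_eq_comp, sub_apply, add_apply, one_apply_eq_self, smul_apply,
      map_add, map_smul]
    rw [h1, sub_add_cancel]
  · ext v
    simp only [mul_apply_eq_comp, sub_apply, add_apply, one_apply_eq_self, smul_apply,
      map_sub, map_smul]
    rw [h2, add_sub_cancel_right]

/-- If a selfadjoint extension has no spectrum at distance at most `r` from the real point `c`,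
then `B - c I` multiplies the norm of every nonzero vector by more than `r`: the norm of the
selfadjoint operator `(B - c I)⁻¹` is its spectral radius, which is attained and so less than
`r⁻¹`. -/
theorem IsSelfAdjointExtension.lt_norm_sub_smul [CompleteSpace H]
    (hB : IsSelfAdjointExtension G B) {c r : ℝ} (hr : 0 < r)
    (hspec : ∀ z ∈ spectrum B, r < ‖z - c‖) {η ω : H} (hm : (η, ω) ∈ B) (hη : η ≠ 0) :
    r * ‖η‖ < ‖ω - (c : ℂ) • η‖ := by
  have hc : (c : ℂ) ∈ resolventSet B := by
    by_contra h
    have := hspec c h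
    simp only [sub_self, norm_zero] at this
    linarith
  obtain ⟨R, hR⟩ := hc
  have memR : ∀ v η, R v = η ↔ (η, v + (c : ℂ) • η) ∈ B := fun v η => by
    rw [← mem_shiftInv, hR, LinearMap.mem_graph_iff]
    exact eq_comm
  have hRsa : IsSelfAdjoint R := by
    rw [ContinuousLinearMap.isSelfAdjoint_iff_isSymmetric]
    intro v w
    have h := inner_eq_of_adjoint_eq hB.adjoint_eq ((memR v _).1 rfl) ((memR w _).1 rfl)
    rw [inner_add_left, inner_add_right, inner_smul_left, inner_smul_right, Complex.conj_ofReal,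
      add_left_inj] at h
    exact h.symm
  have hnt : Nontrivial H := ⟨η, 0, hη⟩
  obtain ⟨ρ, hρ⟩ : ∃ ρ : NNReal, (ρ : ℝ) = r⁻¹ := ⟨⟨r⁻¹, by positivity⟩, rfl⟩
  have hbound : ∀ l ∈ _root_.spectrum ℂ R, ‖l‖₊ < ρ := by
    intro l hl
    rw [← NNReal.coe_lt_coe, coe_nnnorm, hρ]
    rcases eq_or_ne l 0 with rfl | hl0
    · simpa using hr
    have hmem : (c : ℂ) + l⁻¹ ∈ spectrum B := by
      intro hres
      apply hl
      have hu := isUnit_one_sub_smul hR hres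
      have : algebraMap ℂ (H →L[ℂ] H) l - R = l • (1 - l⁻¹ • R) := by
        rw [smul_sub, smul_smul, mul_inv_cancel₀ hl0, one_smul, Algebra.algebraMap_eq_smul_one]
      rw [_root_.spectrum.mem_resolventSet_iff, this]
      exact hu.smul (Units.mk0 l hl0)
    have h := hspec _ hmem
    rw [add_sub_cancel_left, norm_inv] at h
    exact (lt_inv_comm₀ hr (norm_pos_iff.2 hl0)).1 h
  have hnorm : ‖R‖ < r⁻¹ := by
    have h := _root_.spectrum.spectralRadius_lt_of_forall_lt R hbound
    rw [hRsa.spectralRadius_eq_nnnorm, ENNReal.coe_lt_coe, ← NNReal.coe_lt_coe, coe_nnnorm, hρ] at h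
    exact h
  have he : R (ω - (c : ℂ) • η) = η := (memR _ _).2 (by simpa using hm)
  have hpos : 0 < ‖ω - (c : ℂ) • η‖ := by
    rw [norm_pos_iff]
    intro h0
    rw [h0, map_zero] at he
    exact hη he.symm
  have h1 : ‖η‖ < r⁻¹ * ‖ω - (c : ℂ) • η‖ := by
    calc ‖η‖ = ‖R (ω - (c : ℂ) • η)‖ := by rw [he]
      _ ≤ ‖R‖ * ‖ω - (c : ℂ) • η‖ := R.le_opNorm _
      _ < r⁻¹ * ‖ω - (c : ℂ) • η‖ := by gcongr
  rwa [inv_mul_eq_div, lt_div_iff₀ hr, mul_comm] at h1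

/-- Strictly between two points of the spectrum of a selfadjoint extension lies a point of the
spectrum of every other one. Subtracting from an eigenvector `v` of `B₁` for `b` a suitable
vector `u` of its eigenspace for `a` gives a vector `φ` in the domain of `G`, and `G - c I`, for `c`
the midpoint of `a` and `b`, maps it to a vector of norm exactly `(b - a) / 2 * ‖φ‖`. -/
theorem IsSelfAdjointExtension.exists_mem_spectrum_Ioo [CompleteSpace H]
    (hB₁ : IsSelfAdjointExtension G B₁) (hB₂ : IsSelfAdjointExtension G B₂)
    (hG : IsRegularOneOne G) (hne : B₁ ≠ B₂) {a b : ℝ}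
    (hab : a < b) (ha : (a : ℂ) ∈ spectrum B₁) (hb : (b : ℂ) ∈ spectrum B₁) :
    ∃ x : ℝ, (x : ℂ) ∈ spectrum B₂ ∧ x ∈ Set.Ioo a b := by
  by_contra! hno
  set c := (a + b) / 2 with hc
  set r := (b - a) / 2 with hrdef
  have hr : 0 < r := by rw [hrdef]; linarith
  have hspec : ∀ z ∈ spectrum B₂, r < ‖z - c‖ := by
    intro z hz
    have him := hB₂.im_eq_zero hG hz
    obtain ⟨x, rfl⟩ : ∃ x : ℝ, (x : ℂ) = z := ⟨z.re, Complex.ext rfl him.symm⟩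
    rw [← Complex.ofReal_sub, Complex.norm_real, Real.norm_eq_abs, lt_abs]
    have hxa : x ≠ a := by
      rintro rfl
      exact hne (hB₁.eq_of_mem_spectrum hB₂ hG ha hz)
    have hxb : x ≠ b := by
      rintro rfl
      exact hne (hB₁.eq_of_mem_spectrum hB₂ hG hb hz)
    have hx := hno x hz
    rcases lt_or_gt_of_ne hxa with h | h
    · right; linarith
    · rcases lt_or_gt_of_ne hxb with h' | h'
      · exact absurd ⟨h, h'⟩ hx
      · left; linarith
  obtain ⟨v, hv, hv0⟩ := Submodule.exists_mem_ne_zero_of_ne_bot ((hB₁.mem_spectrum_iff hG).1 hb)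
  have hv' : (v, (b : ℂ) • v) ∈ eigenExtension G a := hB₁.eq_eigenExtension hG ha ▸ hv
  obtain ⟨⟨φ, ψ⟩, hφ, u, hu, he⟩ := mem_eigenExtension.1 hv'
  rw [Prod.mk_add_mk, Prod.mk.injEq] at he
  rw [← hB₁.kerShift_eq hG ha] at hu
  have hφe : φ = v - u := eq_sub_of_add_eq he.1
  have hψe : ψ = (b : ℂ) • v - (a : ℂ) • u := eq_sub_of_add_eq he.2
  have huv : inner ℂ u v = 0 := by
    have h := inner_eq_of_adjoint_eq hB₁.adjoint_eq (mem_kerShift.1 hu) (mem_kerShift.1 hv)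
    rw [inner_smul_left, inner_smul_right, Complex.conj_ofReal] at h
    by_contra h0
    exact hab.ne (Complex.ofReal_injective (mul_right_cancel₀ h0 h))
  have hφ0 : φ ≠ 0 := by
    intro h
    rw [hφe, sub_eq_zero] at h
    rw [← h, inner_self_eq_zero] at huv
    exact hv0 huv
  have hlt := hB₂.lt_norm_sub_smul hr hspec (hB₂.le hφ) hφ0
  have hψc : ψ - (c : ℂ) • φ = (r : ℂ) • (v + u) := by
    rw [hψe, hφe, hc, hrdef]
    push_cast
    module
  -- `u` and `v` are orthogonal, so `v + u` and `v - u` have the same norm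
  have hnorm : ‖v + u‖ = ‖v - u‖ := (norm_sub_eq_norm_add huv).symm
  rw [hψc, norm_smul, Complex.norm_real, Real.norm_of_nonneg hr.le, hnorm, hφe] at hlt
  exact lt_irrefl _ hlt

theorem IsSelfAdjointExtension.existsUnique_mem_Ioo [CompleteSpace H]
    (hB₁ : IsSelfAdjointExtension G B₁) (hB₂ : IsSelfAdjointExtension G B₂)
    (hG : IsRegularOneOne G) (hne : B₁ ≠ B₂) {a b : ℝ}
    (ha : a ∈ realSpectrum B₁) (hb : b ∈ realSpectrum B₁) (hab : a < b)
    (hcons : realSpectrum B₁ ∩ Set.Ioo a b = ∅) :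
    ∃! t, t ∈ realSpectrum B₂ ∧ t ∈ Set.Ioo a b := by
  have key : ∀ s t, s ∈ realSpectrum B₂ ∧ s ∈ Set.Ioo a b → t ∈ realSpectrum B₂ ∧ t ∈ Set.Ioo a b →
      ¬ s < t := by
    intro s t hs ht hst
    obtain ⟨x, hx, hxs⟩ := hB₂.exists_mem_spectrum_Ioo hB₁ hG hne.symm hst hs.1 ht.1
    exact Set.eq_empty_iff_forall_notMem.1 hcons x
      ⟨hx, hs.2.1.trans hxs.1, hxs.2.trans ht.2.2⟩
  obtain ⟨t, ht⟩ := hB₁.exists_mem_spectrum_Ioo hB₂ hG hne hab ha hb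
  exact ⟨t, ht, fun s hs => le_antisymm (not_lt.1 (key t s ht hs)) (not_lt.1 (key s t hs ht))⟩

theorem IsCanonicalSelfAdjointExtension.isSelfAdjointExtension {A : H →ₗ.[ℂ] H}
    {B : Submodule ℂ (H × H)} (hB : IsCanonicalSelfAdjointExtension A B) :
    IsSelfAdjointExtension A.graph B :=
  ⟨hB.graph_le, hB.adjoint_eq⟩

end LinRel

theorem mainTheorem6 {H : Type*} [NormedAddCommGroup H] [InnerProductSpace ℂ H] [CompleteSpace H]
    (A : H →ₗ.[ℂ] H) (hA : LinRel.ClassS A) :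
    -- the spectrum consists solely of (real) isolated eigenvalues of multiplicity one
    (∀ B : Submodule ℂ (H × H), LinRel.IsCanonicalSelfAdjointExtension A B →
      ∀ z ∈ LinRel.spectrum B,
        z.im = 0 ∧ Module.finrank ℂ (LinRel.kerShift B z) = 1 ∧
          ∀ᶠ w in 𝓝[≠] z, w ∉ LinRel.spectrum B) ∧
    -- every real number is in the spectrum of exactly one canonical selfadjoint extension
    (∀ x : ℝ, ∃! B : Submodule ℂ (H × H),
      LinRel.IsCanonicalSelfAdjointExtension A B ∧ (x : ℂ) ∈ LinRel.spectrum B) ∧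
    -- the spectra of distinct canonical selfadjoint extensions are interlaced
    (∀ B₁ B₂ : Submodule ℂ (H × H), LinRel.IsCanonicalSelfAdjointExtension A B₁ →
      LinRel.IsCanonicalSelfAdjointExtension A B₂ → B₁ ≠ B₂ →
        LinRel.Interlaced (LinRel.realSpectrum B₁) (LinRel.realSpectrum B₂)) := by
  have hG := hA.isRegularOneOne
  refine ⟨fun B hB z hz => ?_, fun x => ?_, fun B₁ B₂ h₁ h₂ hne => ⟨?_, ?_, ?_⟩⟩
  · have hB' := hB.isSelfAdjointExtension
    refine ⟨hB'.im_eq_zero hG hz, ?_, ?_⟩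
    · rw [hB'.kerShift_eq hG hz]
      exact hG.finrank_eq_one z
    · obtain ⟨d, hd, h⟩ := hG.boundedBelow z
      filter_upwards [self_mem_nhdsWithin,
        mem_nhdsWithin_of_mem_nhds (Metric.ball_mem_nhds z hd)] with w hwz hw hws
      rw [Metric.mem_ball, dist_comm, dist_eq_norm] at hw
      exact hw.not_ge (hB'.le_norm_sub hG h hz hws (Ne.symm hwz))
  · have hE := hG.isSelfAdjointExtension_eigenExtension (Complex.conj_ofReal x)
    exact ⟨LinRel.eigenExtension A.graph x,
      ⟨⟨hE.le, hE.le_adjoint, hE.adjoint_eq⟩, hG.mem_spectrum_eigenExtension⟩,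
      fun B hB => hB.1.isSelfAdjointExtension.eq_eigenExtension hG hB.2⟩
  · exact Set.disjoint_left.2 fun x hx₁ hx₂ => hne
      (h₁.isSelfAdjointExtension.eq_of_mem_spectrum h₂.isSelfAdjointExtension hG hx₁ hx₂)
  · exact fun a ha b hb hab hcons => h₁.isSelfAdjointExtension.existsUnique_mem_Ioo
      h₂.isSelfAdjointExtension hG hne ha hb hab hcons
  · exact fun a ha b hb hab hcons => h₂.isSelfAdjointExtension.existsUnique_mem_Ioo
      h₁.isSelfAdjointExtension hG hne.symm ha hb hab hcons
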